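/- **Setting.** Let $\mathcal V$ be a finite set and $\mathcal E\subset 2^{\mathcal V}$ a hypergraph that contains $\emptyset$ and all singletons and is closed under taking subsets of hyperedges. For each $C\in\mathcal E$ let $f_C\colon\{0,1\}^C\to\mathbb R$ be an arbitrary term, and let $E_f(x)=\sum_{C\in\mathcal E}f_C(x_C)$ for $x\in\{0,1\}^{\mathcal V}$. The full local LP (FLP) relaxation is the polytope $\Lambda_{\mathcal E}$ of all vectors $\mu=(\mu_C(x_C))_{C\in\mathcal E,\,x_C\in\{0,1\}^C}$ with $\mu\ge 0$, $\mu_\emptyset=1$ and $\sum_{x_{C\setminus D}}\mu_C(x_C)=\mu_D(x_D)$ for all $D\subsetneq C$ in $\mathcal E$ and all $x_D$. A node-wise mapping $p(x)_s=p_s(x_s)$ has the linear extension $([p]\mu)_C(x_C)=\sum_{x'_C:\,p_C(x'_C)=x_C}\mu_C(x'_C)$; it is *FLP-improving* for $f$ if $\langle f,[p]\mu\rangle\le\langle f,\mu\rangle$ for all $\mu\in\Lambda_{\mathcal E}$. **HOCR.** Write $E_f$ as a multilinear polynomial. A reduction step chooses a hyperedge $C\in\mathcal E$ with $d=|C|\ge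 3$, a summand $b\prod_{s\in C}x_s$ with $b\neq0$, and a set $\gamma\subset C$ of variables to be flipped. Let $\ell_s=1-x_s$ for $s\in\gamma$, $\ell_s=x_s$ for $s\in C\setminus\gamma$, $a=(-1)^{|\gamma|}b$, $S_1=\sum_{s\in C}\ell_s$ and $S_2=\sum_{\{s,t\}\subset C,\,s\ne t}\ell_s\ell_t$. The step replaces the summand $a\prod_{s\in C}\ell_s$ of the polynomial (whose leading monomial is $b\prod_{s\in C}x_s$; the remaining lower-degree monomials stay in the polynomial) by the quadratic polynomial with new binary variables $w$ * $a\,w\,(S_1-(d-1))$, with one new variable, if $a<0$; * $a\bigl(S_2+\sum_{i=1}^{n_d}w_i\,(c_{i,d}(-S_1+2i)-1)\bigr)$, with $n_d=\lfloor (d-1)/2\rfloor$ new variables, if $a>0$, where $c_{i,d}=1$ if $d$ is odd and $i=n_d$, and $c_{i,d}=2$ otherwise. A run of HOCR is a finite sequence of such steps after which the part of the polynomial in the original variables that has not been replaced has degree at most $2$. Its result is a quadratic pseudo-Boolean function $g$ on $\{0,1\}^{\mathcal V'}$, where $\mathcal V'\supset\mathcal V$ consists of the original nodes and all new variables. **QPBO.**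 The roof dual relaxation of $g$ is its FLP relaxation, with the constant, unary and pairwise terms given by the monomials of $g$, on the hypergraph formed by $\emptyset$, the singletons, and the pairs with a non-zero quadratic coefficient. For an optimal solution $\mu^*$ of it, let $A=\{s\in\mathcal V'\mid \mu^*_s(0)=1\text{ or }\mu^*_s(1)=1\}$ and, for $s\in A$, let $y_s$ be the label with $\mu^*_s(y_s)=1$. The persistency found by QPBO is the partial assignment $y_A$. **Theorem.** For every run of HOCR on $E_f$: 1. for every node-wise mapping $p'$ on $\{0,1\}^{\mathcal V'}$ that is FLP-improving for the reduced quadratic problem $g$, the corresponding mapping $p$ of the original problem, $p_s=p'_s$ for $s\in\mathcal V$, is FLP-improving for $f$; 2. for every optimal solution $\mu^*$ of the roof dual relaxation of $g$, the persistency $y_A$ restricted to the original variables corresponds to an FLP-improving mapping of the original problem: the mapping $p_s\equiv y_s$ for $s\in A\cap\mathcal V$ and $p_s=\mathrm{id}$ for $s\in\mathcal V\setminus A$ is FLP-improving for $f$. -/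

import Mathlib

open scoped BigOperators

noncomputable section

/-- The hypergraph of an energy minimization problem with node set `V`; its finitely many
hyperedges include the empty set and all singletons. -/
structure EnergyHypergraph (V : Type*) where
  edges : Finset (Finset V)
  empty_mem : ∅ ∈ edges
  singleton_mem : ∀ s : V, {s} ∈ edges

namespace EnergyHypergraph

variable {V : Type*} [DecidableEq V]

/-- Assignments of Boolean labels to the nodes of `C`. -/
abbrev LabelingOn (C : Finset V) : Type _ := {s // s ∈ C} → Bool

/-- The restriction of a labeling on `C` to a subset `D`. -/
def LabelingOn.restrict {C D : Finset V} (h : D ⊆ C) (x : LabelingOn C) : LabelingOn D :=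
  fun s => x ⟨s.1, h s.2⟩

/-- The node-wise mapping `p` applied to a labeling on `C`. -/
def LabelingOn.map {C : Finset V} (p : V → Bool → Bool) (x : LabelingOn C) : LabelingOn C :=
  fun s => p s.1 (x s)

/-- Every subset of a hyperedge is a hyperedge (the standing assumption of the FLP relaxation). -/
def DownClosed (H : EnergyHypergraph V) : Prop :=
  ∀ C ∈ H.edges, ∀ D, D ⊆ C → D ∈ H.edges

/-- The space of vectors with one real component for each hyperedge `C` and each assignment
of Boolean labels to the nodes of `C`. Both the terms of an energy function and the relaxed
labelings live in it. -/
abbrev Vec (H : EnergyHypergraph V) : Type _ :=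
  (C : {C : Finset V // C ∈ H.edges}) → LabelingOn C.1 → ℝ

/-- The scalar product `⟨f, μ⟩`. -/
def pairing (H : EnergyHypergraph V) (f μ : H.Vec) : ℝ :=
  ∑ C, ∑ x, f C x * μ C x

/-- The energy `E_f(x) = ∑_C f_C(x_C)`. -/
def energy (H : EnergyHypergraph V) (f : H.Vec) (x : V → Bool) : ℝ :=
  ∑ C : {C : Finset V // C ∈ H.edges}, f C (fun s => x s.1)

/-- The local polytope with all marginalization constraints
`∑_{x_{C \ D}} μ_C(x_C) = μ_D(x_D)` for hyperedges `D ⊂ C`. -/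
def flp (H : EnergyHypergraph V) : Set H.Vec :=
  {μ | (∀ C x, 0 ≤ μ C x) ∧
    (∀ x, μ ⟨∅, H.empty_mem⟩ x = 1) ∧
    ∀ (C D : {C : Finset V // C ∈ H.edges}) (h : D.1 ⊂ C.1)
      (y : LabelingOn D.1),
      ∑ x : LabelingOn C.1 with x.restrict h.subset = y, μ C x = μ D y}

/-- The linear extension `[p]` of the node-wise mapping `p(x)_s = p_s(x_s)`. -/
def extension (H : EnergyHypergraph V) (p : V → Bool → Bool) (μ : H.Vec) : H.Vec :=
  fun C x => ∑ x' : LabelingOn C.1 with x'.map p = x, μ C x'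

/-- The node-wise mapping `p` is (weakly) FLP-improving for `f`. -/
def FLPImproving (H : EnergyHypergraph V) (f : H.Vec) (p : V → Bool → Bool) : Prop :=
  ∀ μ ∈ H.flp, H.pairing f (H.extension p μ) ≤ H.pairing f μ

end EnergyHypergraph

/-- The coefficient of the monomial `∏_{s ∈ C} x_s` in the unique multilinear polynomial
representing the pseudo-Boolean function `F` (Möbius inversion). -/
def multilinearCoeff {U : Type*} [DecidableEq U] (F : (U → Bool) → ℝ) (C : Finset U) : ℝ :=
  ∑ D ∈ C.powerset, (-1) ^ (C \ D).card * F (fun s => decide (s ∈ D))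

/-- The pseudo-Boolean function `F` has degree at most two as a multilinear polynomial. -/
def IsQuadratic {U : Type*} [DecidableEq U] (F : (U → Bool) → ℝ) : Prop :=
  ∀ C : Finset U, 2 < C.card → multilinearCoeff F C = 0

/-- The real number `0` or `1` given by a Boolean. -/
def boolVal (b : Bool) : ℝ := if b then 1 else 0

/-- One order-reduction step: the summand `coeff * ∏_{s ∈ clique} x_s` of the polynomial is
to be eliminated through the product of literals in which the variables in `flip` are
complemented. -/
structure ReductionStep {V : Type*} (H : EnergyHypergraph V) where
  clique : Finset V
  clique_mem : clique ∈ H.edges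
  three_le_card : 3 ≤ clique.card
  flip : Finset V
  flip_subset : flip ⊆ clique
  coeff : ℝ
  coeff_ne_zero : coeff ≠ 0

namespace ReductionStep

variable {V : Type*} [DecidableEq V] {H : EnergyHypergraph V}

/-- The literal of the variable `s`: `1 - x_s` if `s` is flipped, `x_s` otherwise. -/
def literal (r : ReductionStep H) (x : V → Bool) (s : V) : ℝ :=
  if s ∈ r.flip then 1 - boolVal (x s) else boolVal (x s)

/-- `(-1)^{|flip|} * coeff`, so that `signedCoeff * ∏ literals` has leading monomial
`coeff * ∏_{s ∈ clique} x_s`. -/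
def signedCoeff (r : ReductionStep H) : ℝ := (-1) ^ r.flip.card * r.coeff

/-- The summand `signedCoeff * ∏ literals` that the step replaces. -/
def flippedTerm (r : ReductionStep H) (x : V → Bool) : ℝ :=
  r.signedCoeff * ∏ s ∈ r.clique, r.literal x s

/-- The sum `S₁` of the literals. -/
def sumOne (r : ReductionStep H) (x : V → Bool) : ℝ :=
  ∑ s ∈ r.clique, r.literal x s

/-- The sum `S₂` of the products of two different literals. -/
def sumTwo (r : ReductionStep H) (x : V → Bool) : ℝ :=
  ∑ T ∈ r.clique.powersetCard 2, ∏ s ∈ T, r.literal x s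

/-- The number of auxiliary variables: one for a negative coefficient and
`⌊(d - 1) / 2⌋` for a positive coefficient, where `d` is the degree. -/
def numAux (r : ReductionStep H) : ℕ :=
  if r.signedCoeff < 0 then 1 else (r.clique.card - 1) / 2

/-- The quadratic polynomial replacing `signedCoeff * ∏ literals`. With `a = signedCoeff`:
* if `a < 0`: `a * w * (S₁ - (d - 1))`;
* if `a > 0`: `a * (S₂ + ∑_{i=1}^{n} w_i * (c_i * (-S₁ + 2 * i) - 1))` with
  `n = ⌊(d - 1) / 2⌋`, and `c_i = 1` if `d` is odd and `i = n`, `c_i = 2` otherwise. -/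
def quadraticTerm (r : ReductionStep H) (x : V → Bool) (w : Fin r.numAux → Bool) : ℝ :=
  if r.signedCoeff < 0 then
    r.signedCoeff * ∑ i, boolVal (w i) * (r.sumOne x - ((r.clique.card : ℝ) - 1))
  else
    r.signedCoeff * (r.sumTwo x + ∑ i : Fin r.numAux, boolVal (w i) *
      ((if Odd r.clique.card ∧ (i : ℕ) + 1 = (r.clique.card - 1) / 2 then 1 else 2) *
        (-r.sumOne x + 2 * ((i : ℝ) + 1)) - 1))

end ReductionStep

/-- A complete run of Higher Order Clique Reduction on the energy `E_f`: a finite sequence of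
order-reduction steps (each one with its own choice of flipped variables) after which what
remains of the polynomial in the original variables is quadratic. -/
structure HOCR {V : Type*} [DecidableEq V] (H : EnergyHypergraph V) (f : H.Vec) where
  numSteps : ℕ
  step : Fin numSteps → ReductionStep H
  residual_quadratic : IsQuadratic fun x => H.energy f x - ∑ k, (step k).flippedTerm x

namespace HOCR

variable {V : Type*} [DecidableEq V] {H : EnergyHypergraph V} {f : H.Vec}

/-- The nodes of the reduced problem: the original nodes and the auxiliary variables. -/
abbrev Node (R : HOCR H f) : Type _ := V ⊕ (Σ k : Fin R.numSteps, Fin (R.step k).numAux)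

/-- The reduced quadratic pseudo-Boolean function: each replaced summand gives way to its
quadratic polynomial in the original and the new auxiliary variables. -/
def reduced (R : HOCR H f) (z : R.Node → Bool) : ℝ :=
  H.energy f (fun s => z (Sum.inl s))
    - ∑ k, (R.step k).flippedTerm (fun s => z (Sum.inl s))
    + ∑ k, (R.step k).quadraticTerm (fun s => z (Sum.inl s)) (fun i => z (Sum.inr ⟨k, i⟩))

end HOCR

namespace QPBO

variable {U : Type*} [Fintype U] [DecidableEq U]

/-- The graph of a quadratic pseudo-Boolean function: the empty set, all nodes, and
the pairs with a non-zero quadratic coefficient. -/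
def graph (F : (U → Bool) → ℝ) : EnergyHypergraph U where
  edges := Finset.univ.filter fun C =>
    C.card ≤ 1 ∨ (C.card = 2 ∧ multilinearCoeff F C ≠ 0)
  empty_mem := by simp
  singleton_mem := by simp

/-- The constant, unary and pairwise terms of a quadratic pseudo-Boolean function. -/
def terms (F : (U → Bool) → ℝ) : (graph F).Vec :=
  fun C x => multilinearCoeff F C * ∏ s, boolVal (x s)

/-- `μ` is an optimal solution of the roof dual relaxation of `F`. -/
def IsOptimal (F : (U → Bool) → ℝ) (μ : (graph F).Vec) : Prop :=
  μ ∈ (graph F).flp ∧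
    ∀ ν ∈ (graph F).flp, (graph F).pairing (terms F) μ ≤ (graph F).pairing (terms F) ν

/-- The relaxed label of the node `s` is integral and equal to `b`. -/
def Persistent {F : (U → Bool) → ℝ} (μ : (graph F).Vec) (s : U) (b : Bool) : Prop :=
  μ ⟨{s}, (graph F).singleton_mem s⟩ (fun _ => b) = 1

open Classical in
/-- The overwrite mapping `x ↦ x[A ← y]`, where `A` is the set of nodes at which `μ` is
integral and `y` is the integral part of `μ`. -/
def overwrite {F : (U → Bool) → ℝ} (μ : (graph F).Vec) (s : U) (b : Bool) : Bool :=
  if Persistent μ s true then true else if Persistent μ s false then false else b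

end QPBO

end

/-! ### Multilinear coefficients and quadratic pseudo-Boolean functions. -/

section Multilinear

variable {U : Type*} [DecidableEq U]

/-! A relaxed labeling `ν` of the original problem lifts to one of the reduced problem. Each
auxiliary variable is assigned its optimal value, a function of the labels on one clique
(`HOCR.lift`), and `ν` is pushed forward along `x ↦ (x, w(x))`. This is possible because every edge
of the reduced graph involves original nodes of a single hyperedge only (`HOCR.biUnion_scope_mem`),
where `ν` supplies a genuine local distribution; down-closedness makes all subsets of hyperedges
available. The lift has cost `⟨f, ν⟩`, since the optimal auxiliary values recover each replaced term
exactly.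

Applying `p'` to the lift may make the auxiliary values suboptimal, which only raises the cost: each
quadratic replacement majorizes its term (`ReductionStep.flippedTerm_le_quadraticTerm`), and the gap
depends on one clique, so its local expectation is nonnegative. Writing `ν'` for the lift, `⟨f,
[p]ν⟩ ≤ ⟨g, [p']ν'⟩ ≤ ⟨g, ν'⟩ = ⟨f, ν⟩`.

For the second claim it then suffices that overwriting with the integral part of an optimal `μ` is
improving for `g`. If it strictly increased the cost of some `ν`, moving `μ` slightly along `ν -
[p]ν` would stay feasible and lower its cost. No half-integrality is needed. -/

theorem multilinearCoeff_add (F G : (U → Bool) → ℝ) (C : Finset U) :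
    multilinearCoeff (fun x => F x + G x) C = multilinearCoeff F C + multilinearCoeff G C := by
  simp [multilinearCoeff, mul_add, Finset.sum_add_distrib]

theorem multilinearCoeff_sub (F G : (U → Bool) → ℝ) (C : Finset U) :
    multilinearCoeff (fun x => F x - G x) C = multilinearCoeff F C - multilinearCoeff G C := by
  simp [multilinearCoeff, mul_sub, Finset.sum_sub_distrib]

theorem multilinearCoeff_const_mul (a : ℝ) (F : (U → Bool) → ℝ) (C : Finset U) :
    multilinearCoeff (fun x => a * F x) C = a * multilinearCoeff F C := by
  simp only [multilinearCoeff, Finset.mul_sum]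
  exact Finset.sum_congr rfl fun _ _ => by ring

theorem multilinearCoeff_sum {ι : Type*} (S : Finset ι) (F : ι → (U → Bool) → ℝ) (C : Finset U) :
    multilinearCoeff (fun x => ∑ i ∈ S, F i x) C = ∑ i ∈ S, multilinearCoeff (F i) C := by
  simp only [multilinearCoeff, Finset.mul_sum]
  exact Finset.sum_comm

/-- The subsets `D` and `D ∪ {s}` carry opposite signs and equal values, so they cancel in pairs.
All degree bounds and all locality statements below rest on this. -/
theorem multilinearCoeff_eq_zero_of_dependsOn {F : (U → Bool) → ℝ} {T : Set U}
    (hF : DependsOn F T) {C : Finset U} {s : U} (hs : s ∈ C) (hsT : s ∉ T) :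
    multilinearCoeff F C = 0 := by
  obtain ⟨C, hsC, rfl⟩ : ∃ C' : Finset U, s ∉ C' ∧ insert s C' = C :=
    ⟨C.erase s, Finset.notMem_erase s C, Finset.insert_erase hs⟩
  rw [multilinearCoeff, Finset.sum_powerset_insert hsC, ← Finset.sum_add_distrib]
  refine Finset.sum_eq_zero fun D hD => ?_
  have hsD : s ∉ D := fun h => hsC (Finset.mem_powerset.1 hD h)
  have h1 : (insert s C \ D).card = (C \ D).card + 1 := by
    rw [Finset.insert_sdiff_of_notMem _ hsD, Finset.card_insert_of_notMem]
    exact fun h => hsC (Finset.mem_sdiff.1 h).1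
  have h2 : insert s C \ insert s D = C \ D := by
    ext t
    by_cases hts : t = s
    · subst hts; simp [hsC]
    · simp [hts]
  have h3 : F (fun t => decide (t ∈ insert s D)) = F (fun t => decide (t ∈ D)) := by
    refine hF fun t ht => ?_
    have : t ≠ s := fun h => hsT (h ▸ ht)
    simp [this]
  rw [h1, h2, h3, pow_succ]
  ring

/-- Möbius inversion on the lattice of finite sets. -/
theorem sum_powerset_moebius (G : Finset U → ℝ) (X : Finset U) :
    ∑ C ∈ X.powerset, ∑ D ∈ C.powerset, (-1) ^ (C \ D).card * G D = G X := by
  induction X using Finset.induction_on generalizing G with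
  | empty => simp
  | insert a X ha ih =>
    rw [Finset.sum_powerset_insert ha, ih G]
    have key : ∀ C ∈ X.powerset,
        ∑ D ∈ (insert a C).powerset, (-1 : ℝ) ^ (insert a C \ D).card * G D =
          (∑ D ∈ C.powerset, (-1) ^ (C \ D).card * G (insert a D)) -
            ∑ D ∈ C.powerset, (-1) ^ (C \ D).card * G D := by
      intro C hC
      have haC : a ∉ C := fun h => ha (Finset.mem_powerset.1 hC h)
      rw [Finset.sum_powerset_insert haC, ← Finset.sum_add_distrib, ← Finset.sum_sub_distrib]
      refine Finset.sum_congr rfl fun D hD => ?_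
      have haD : a ∉ D := fun h => haC (Finset.mem_powerset.1 hD h)
      have h1 : (insert a C \ D).card = (C \ D).card + 1 := by
        rw [Finset.insert_sdiff_of_notMem _ haD, Finset.card_insert_of_notMem]
        exact fun h => haC (Finset.mem_sdiff.1 h).1
      have h2 : insert a C \ insert a D = C \ D := by
        ext t
        by_cases hta : t = a
        · subst hta; simp [haC]
        · simp [hta]
      rw [h1, h2, pow_succ]
      ring
    rw [Finset.sum_congr rfl key, Finset.sum_sub_distrib, ih G, ih fun D => G (insert a D)]
    ring

theorem prod_boolVal {ι : Type*} (S : Finset ι) (x : ι → Bool) :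
    ∏ s ∈ S, boolVal (x s) = if ∀ s ∈ S, x s = true then 1 else 0 := by
  simp only [boolVal]
  rw [Finset.prod_ite_zero]
  simp

/-- A pseudo-Boolean function is the sum of its multilinear monomials. -/
theorem sum_multilinearCoeff [Fintype U] (F : (U → Bool) → ℝ) (x : U → Bool) :
    ∑ C, multilinearCoeff F C * ∏ s ∈ C, boolVal (x s) = F x := by
  have h := sum_powerset_moebius (fun D => F fun s => decide (s ∈ D))
    (Finset.univ.filter fun s => x s = true)
  have hx : (fun s => decide (s ∈ Finset.univ.filter fun s => x s = true)) = x := by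
    funext s; simp
  rw [hx] at h
  rw [← h]
  simp only [prod_boolVal, mul_ite, mul_one, mul_zero]
  rw [← Finset.sum_filter]
  refine Finset.sum_congr ?_ fun _ _ => rfl
  ext C
  simp [Finset.subset_iff]

namespace IsQuadratic

theorem add {F G : (U → Bool) → ℝ} (hF : IsQuadratic F) (hG : IsQuadratic G) :
    IsQuadratic fun x => F x + G x := fun C hC => by
  rw [multilinearCoeff_add, hF C hC, hG C hC, add_zero]

theorem const_mul (a : ℝ) {F : (U → Bool) → ℝ} (hF : IsQuadratic F) :
    IsQuadratic fun x => a * F x := fun C hC => by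
  rw [multilinearCoeff_const_mul, hF C hC, mul_zero]

theorem sum {ι : Type*} {S : Finset ι} {F : ι → (U → Bool) → ℝ}
    (hF : ∀ i ∈ S, IsQuadratic (F i)) : IsQuadratic fun x => ∑ i ∈ S, F i x := fun C hC => by
  rw [multilinearCoeff_sum]
  exact Finset.sum_eq_zero fun i hi => hF i hi C hC

theorem of_dependsOn {F : (U → Bool) → ℝ} {T : Finset U} (hF : DependsOn F (T : Set U))
    (hT : T.card ≤ 2) : IsQuadratic F := fun C hC => by
  obtain ⟨s, hs, hsT⟩ := Finset.exists_mem_notMem_of_card_lt_card (hT.trans_lt hC)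
  exact multilinearCoeff_eq_zero_of_dependsOn hF hs (by simpa using hsT)

/-- A quadratic function stays quadratic when its variables are embedded into a larger set. -/
theorem comp_embedding {W : Type*} [DecidableEq W] {F : (W → Bool) → ℝ} (hF : IsQuadratic F)
    (e : W ↪ U) : IsQuadratic fun x : U → Bool => F fun s => x (e s) := fun C hC => by
  by_cases h : ∀ u ∈ C, u ∈ Set.range e
  · obtain ⟨D, rfl⟩ : ∃ D : Finset W, D.map e = C := by
      refine ⟨C.preimage e e.injective.injOn, ?_⟩
      ext u
      simp only [Finset.mem_map, Finset.mem_preimage]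
      constructor
      · rintro ⟨s, hs, rfl⟩; exact hs
      · intro hu
        obtain ⟨s, rfl⟩ := h u hu
        exact ⟨s, hu, rfl⟩
    rw [Finset.card_map] at hC
    rw [← hF D hC, multilinearCoeff, multilinearCoeff]
    refine (Finset.sum_bij (fun T _ => T.map e) (fun T hT => ?_)
      (fun T _ T' _ h => Finset.map_injective e h) (fun T hT => ?_) (fun T hT => ?_)).symm
    · exact Finset.mem_powerset.2 (Finset.map_subset_map.2 (Finset.mem_powerset.1 hT))
    · obtain ⟨T', hT', rfl⟩ := Finset.subset_map_iff.1 (Finset.mem_powerset.1 hT)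
      exact ⟨T', Finset.mem_powerset.2 hT', rfl⟩
    · simp [← Finset.map_sdiff]
  · push Not at h
    obtain ⟨u, hu, hur⟩ := h
    refine multilinearCoeff_eq_zero_of_dependsOn (T := Set.range e) (fun x y hxy => ?_) hu hur
    exact congrArg F (funext fun s => hxy _ ⟨s, rfl⟩)

end IsQuadratic

end Multilinear

/-! ### Local distributions and expectations of relaxed labelings. -/

namespace EnergyHypergraph

section Relaxation

variable {V : Type*} [DecidableEq V] {H : EnergyHypergraph V}

/-- The extension of a labeling on `C` to all nodes by `false`. -/
noncomputable def LabelingOn.extend {C : Finset V} (x : LabelingOn C) : V → Bool :=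
  fun s => if h : s ∈ C then x ⟨s, h⟩ else false

theorem LabelingOn.extend_of_mem {C : Finset V} (x : LabelingOn C) {s : V} (h : s ∈ C) :
    x.extend s = x ⟨s, h⟩ := by
  simp [LabelingOn.extend, h]

/-- The marginalization constraints integrated against a test function. Unlike the constraints, it
allows `D = C`; indicator test functions recover the pointwise form. -/
theorem sum_mul_restrict {ν : H.Vec} (hν : ν ∈ H.flp) (C D : {C : Finset V // C ∈ H.edges})
    (h : D.1 ⊆ C.1) (g : LabelingOn D.1 → ℝ) :
    ∑ x, ν C x * g (x.restrict h) = ∑ y, ν D y * g y := by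
  by_cases hCD : D.1 = C.1
  · obtain rfl : D = C := Subtype.ext hCD
    rfl
  · have hss : D.1 ⊂ C.1 := lt_of_le_of_ne h hCD
    have hm := hν.2.2 C D hss
    rw [← Finset.sum_fiberwise (s := Finset.univ) (g := fun x : LabelingOn C.1 => x.restrict h)]
    refine Finset.sum_congr rfl fun y _ => ?_
    rw [← hm y, Finset.sum_mul]
    refine Finset.sum_congr rfl fun x hx => ?_
    rw [(Finset.mem_filter.1 hx).2]

theorem sum_eq_one {ν : H.Vec} (hν : ν ∈ H.flp) (C : {C : Finset V // C ∈ H.edges}) :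
    ∑ x, ν C x = 1 := by
  have h := sum_mul_restrict hν C ⟨∅, H.empty_mem⟩ (Finset.empty_subset _) fun _ => 1
  simp only [mul_one] at h
  rw [h]
  simp [hν.2.1]

theorem pairing_extension (f ν : H.Vec) (p : V → Bool → Bool) :
    H.pairing f (H.extension p ν) = ∑ C, ∑ x, f C (x.map p) * ν C x := by
  refine Finset.sum_congr rfl fun C _ => ?_
  rw [← Finset.sum_fiberwise (s := Finset.univ) (g := fun x : LabelingOn C.1 => x.map p)
    (f := fun x => f C (x.map p) * ν C x)]
  refine Finset.sum_congr rfl fun y _ => ?_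
  rw [extension, Finset.mul_sum]
  refine Finset.sum_congr rfl fun x hx => ?_
  rw [(Finset.mem_filter.1 hx).2]

theorem extension_id (ν : H.Vec) : H.extension (fun _ b => b) ν = ν := by
  funext C x
  have hmap : ∀ x' : LabelingOn C.1, x'.map (fun _ b => b) = x' := fun _ => rfl
  simp only [extension, hmap, Finset.sum_filter, Finset.sum_ite_eq', Finset.mem_univ, if_true]

/-- The linear functional that evaluates a pseudo-Boolean function on a relaxed labeling,
monomial by monomial. -/
noncomputable def expect (H : EnergyHypergraph V) (ν : H.Vec) (F : (V → Bool) → ℝ) : ℝ :=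
  ∑ C : {C : Finset V // C ∈ H.edges}, multilinearCoeff F C * ν C fun _ => true

theorem expect_add (ν : H.Vec) (F G : (V → Bool) → ℝ) :
    H.expect ν (fun x => F x + G x) = H.expect ν F + H.expect ν G := by
  simp [expect, multilinearCoeff_add, add_mul, Finset.sum_add_distrib]

theorem expect_sum {ι : Type*} (S : Finset ι) (ν : H.Vec) (F : ι → (V → Bool) → ℝ) :
    H.expect ν (fun x => ∑ i ∈ S, F i x) = ∑ i ∈ S, H.expect ν (F i) := by
  simp only [expect, multilinearCoeff_sum, Finset.sum_mul]
  exact Finset.sum_comm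

variable [Fintype V]

/-- On functions of the nodes of a single hyperedge `D`, `expect` is the expected value with
respect to the local distribution `ν D`. -/
theorem expect_of_dependsOn (hH : H.DownClosed) {ν : H.Vec} (hν : ν ∈ H.flp)
    {F : (V → Bool) → ℝ} (D : {C : Finset V // C ∈ H.edges}) (hF : DependsOn F (D.1 : Set V)) :
    H.expect ν F = ∑ x, ν D x * F x.extend := by
  have hz : ∀ C : Finset V, ¬ C ⊆ D.1 → multilinearCoeff F C = 0 := by
    intro C hC
    obtain ⟨s, hs, hsD⟩ := Finset.not_subset.1 hC
    exact multilinearCoeff_eq_zero_of_dependsOn hF hs (by simpa using hsD)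
  -- The moment of the monomial over `C` is the probability of the all-ones label on `C`, obtained
  -- by marginalizing the indicator of that label.
  have hmom : ∀ C : {C : Finset V // C ∈ H.edges}, C.1 ⊆ D.1 →
      ∑ x, ν D x * ∏ s ∈ C.1, boolVal (x.extend s) = ν C fun _ => true := by
    intro C hC
    have h := sum_mul_restrict hν D C hC fun y => if y = fun _ => true then 1 else 0
    rw [Finset.sum_eq_single (s := Finset.univ) (f := fun y => ν C y * _) (fun _ => true)] at h
    · rw [if_pos rfl, mul_one] at h
      rw [← h]
      refine Finset.sum_congr rfl fun x _ => ?_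
      have hiff : (∀ s ∈ C.1, x.extend s = true) ↔ x.restrict hC = fun _ => true := by
        constructor
        · intro hx
          funext s
          rw [← hx s.1 s.2, LabelingOn.extend_of_mem x (hC s.2)]
          rfl
        · intro hx s hs
          rw [LabelingOn.extend_of_mem x (hC hs)]
          exact congrFun hx ⟨s, hs⟩
      simp only [prod_boolVal, hiff]
    · intro y _ hy
      rw [if_neg hy, mul_zero]
    · simp
  calc H.expect ν F
      = ∑ C : {C : Finset V // C ∈ H.edges},
          multilinearCoeff F C * ∑ x, ν D x * ∏ s ∈ C.1, boolVal (x.extend s) := by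
        refine Finset.sum_congr rfl fun C _ => ?_
        by_cases hC : C.1 ⊆ D.1
        · rw [hmom C hC]
        · rw [hz C.1 hC, zero_mul, zero_mul]
    _ = ∑ C ∈ H.edges,
          multilinearCoeff F C * ∑ x, ν D x * ∏ s ∈ C, boolVal (x.extend s) :=
        Finset.sum_coe_sort H.edges fun C =>
          multilinearCoeff F C * ∑ x, ν D x * ∏ s ∈ C, boolVal (x.extend s)
    -- Down-closedness enters here: a set that is not a hyperedge is not contained in `D`, so its
    -- coefficient vanishes.
    _ = ∑ C, multilinearCoeff F C * ∑ x, ν D x * ∏ s ∈ C, boolVal (x.extend s) := by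
        refine Finset.sum_subset (Finset.subset_univ _) fun C _ hC => ?_
        rw [hz C fun h => hC (hH D.1 D.2 C h), zero_mul]
    _ = ∑ x, ν D x * F x.extend := by
        simp only [Finset.mul_sum]
        rw [Finset.sum_comm]
        refine Finset.sum_congr rfl fun x _ => ?_
        rw [← sum_multilinearCoeff F x.extend, Finset.mul_sum]
        exact Finset.sum_congr rfl fun C _ => by ring

theorem expect_nonneg_of_dependsOn (hH : H.DownClosed) {ν : H.Vec} (hν : ν ∈ H.flp)
    {F : (V → Bool) → ℝ} (D : {C : Finset V // C ∈ H.edges}) (hF : DependsOn F (D.1 : Set V))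
    (h0 : ∀ x, 0 ≤ F x) : 0 ≤ H.expect ν F := by
  rw [expect_of_dependsOn hH hν D hF]
  exact Finset.sum_nonneg fun x _ => mul_nonneg (hν.1 D x) (h0 _)

/-- Each `f C` after relabeling still depends on `C` alone, so the sides agree hyperedge by
hyperedge. The identity mapping gives `⟨f, ν⟩` itself. -/
theorem pairing_extension_eq_expect (hH : H.DownClosed) (f : H.Vec) {ν : H.Vec}
    (hν : ν ∈ H.flp) (p : V → Bool → Bool) :
    H.pairing f (H.extension p ν) = H.expect ν fun x => H.energy f fun s => p s (x s) := by
  rw [pairing_extension]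
  unfold energy
  rw [expect_sum]
  refine Finset.sum_congr rfl fun C _ => ?_
  rw [expect_of_dependsOn hH hν C]
  · refine Finset.sum_congr rfl fun x _ => ?_
    rw [mul_comm]
    congr 2
    funext s
    exact congrArg (p s.1) (LabelingOn.extend_of_mem x s.2).symm
  · intro x y hxy
    exact congrArg (f C) (funext fun s => congrArg (p s.1) (hxy s.1 s.2))

end Relaxation

/-! ### Push-forward of relaxed labelings. -/

section PushForward

variable {V U : Type*} [DecidableEq V] [DecidableEq U]
  {H : EnergyHypergraph V} {G : EnergyHypergraph U}

/-- The push-forward of a relaxed labeling `ν` along a map of labelings `φ` whose component at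
`u` is a function of the nodes in `scope u`. -/
noncomputable def pushForward (φ : U → (V → Bool) → Bool) (scope : U → Finset V)
    (host : ∀ C ∈ G.edges, C.biUnion scope ∈ H.edges) (ν : H.Vec) : G.Vec :=
  fun C z => ∑ x : LabelingOn (C.1.biUnion scope) with (fun u : {u // u ∈ C.1} => φ u.1 x.extend) = z,
    ν ⟨C.1.biUnion scope, host C.1 C.2⟩ x

theorem sum_mul_pushForward {φ : U → (V → Bool) → Bool} {scope : U → Finset V}
    (host : ∀ C ∈ G.edges, C.biUnion scope ∈ H.edges) (ν : H.Vec)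
    (C : {C : Finset U // C ∈ G.edges}) (g : LabelingOn C.1 → ℝ) :
    ∑ z, g z * pushForward φ scope host ν C z =
      ∑ x : LabelingOn (C.1.biUnion scope), ν ⟨C.1.biUnion scope, host C.1 C.2⟩ x *
        g fun u => φ u.1 x.extend := by
  rw [← Finset.sum_fiberwise (s := Finset.univ)
    (g := fun (x : LabelingOn (C.1.biUnion scope)) (u : {u // u ∈ C.1}) => φ u.1 x.extend)]
  refine Finset.sum_congr rfl fun z _ => ?_
  rw [pushForward, Finset.mul_sum]
  refine Finset.sum_congr rfl fun x hx => ?_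
  rw [(Finset.mem_filter.1 hx).2, mul_comm]

/-- Marginals are inherited from `ν` on the larger scope sets: `φ u` sees only `scope u`, so
restricting a labeling to a smaller scope set does not change its value. -/
theorem pushForward_mem_flp {φ : U → (V → Bool) → Bool} {scope : U → Finset V}
    (hφ : ∀ u, DependsOn (φ u) (scope u : Set V))
    (host : ∀ C ∈ G.edges, C.biUnion scope ∈ H.edges) {ν : H.Vec} (hν : ν ∈ H.flp) :
    pushForward φ scope host ν ∈ G.flp := by
  refine ⟨fun C z => Finset.sum_nonneg fun x _ => hν.1 _ _, fun z => ?_, fun C D h y => ?_⟩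
  · have h1 := sum_mul_pushForward (φ := φ) host ν ⟨∅, G.empty_mem⟩ fun _ => 1
    simp only [one_mul, mul_one] at h1
    replace h1 := h1.trans (sum_eq_one hν ⟨_, host ∅ G.empty_mem⟩)
    rw [← h1]
    symm
    refine Fintype.sum_eq_single z fun z' hz' => ?_
    exact absurd (funext fun u => absurd u.2 (Finset.notMem_empty _)) hz'
  · have hsub : D.1.biUnion scope ⊆ C.1.biUnion scope :=
      Finset.biUnion_subset_biUnion_of_subset_left _ h.subset
    have hC := sum_mul_pushForward (φ := φ) host ν C
      fun z => if z.restrict h.subset = y then 1 else 0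
    have hD := sum_mul_pushForward (φ := φ) host ν D fun z => if z = y then 1 else 0
    simp only [ite_mul, one_mul, zero_mul, Finset.sum_ite_eq', Finset.mem_univ, if_true] at hD
    rw [hD, Finset.sum_filter]
    simp only [ite_mul, one_mul, zero_mul] at hC
    rw [hC, ← sum_mul_restrict hν ⟨_, host C.1 C.2⟩ ⟨_, host D.1 D.2⟩ hsub]
    refine Finset.sum_congr rfl fun x _ => ?_
    congr 2
    refine congrArg (· = y) (funext fun u => ?_)
    refine hφ u.1 fun s hs => ?_
    have hsD : s ∈ D.1.biUnion scope := Finset.mem_biUnion.2 ⟨u.1, u.2, hs⟩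
    rw [LabelingOn.extend_of_mem _ hsD, LabelingOn.extend_of_mem _ (hsub hsD)]
    rfl

theorem pairing_extension_pushForward [Fintype V] (hH : H.DownClosed)
    {φ : U → (V → Bool) → Bool} {scope : U → Finset V}
    (hφ : ∀ u, DependsOn (φ u) (scope u : Set V))
    (host : ∀ C ∈ G.edges, C.biUnion scope ∈ H.edges) {ν : H.Vec} (hν : ν ∈ H.flp)
    (t : G.Vec) (p : U → Bool → Bool) :
    G.pairing t (G.extension p (pushForward φ scope host ν)) =
      H.expect ν fun x => G.energy t fun u => p u (φ u x) := by
  rw [pairing_extension]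
  unfold energy
  rw [expect_sum]
  refine Finset.sum_congr rfl fun C _ => ?_
  rw [sum_mul_pushForward host ν C fun z => t C (z.map p),
    expect_of_dependsOn hH hν ⟨_, host C.1 C.2⟩]
  · rfl
  · intro x y hxy
    refine congrArg (t C) (funext fun u => ?_)
    exact congrArg (p u.1) (hφ u.1 fun s hs =>
      hxy s (Finset.mem_coe.2 (Finset.mem_biUnion.2 ⟨u.1, u.2, hs⟩)))

end PushForward

end EnergyHypergraph

/-! ### Arithmetic of Ishikawa's reduction. -/

theorem sum_min_slope_of_le {m n : ℕ} (h : 2 * n ≤ m) :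
    ∑ i ∈ Finset.range n, min (2 * (-(m : ℝ) + 2 * ((i : ℝ) + 1)) - 1) 0 =
      2 * n * (n + 1) - (2 * m + 1) * n := by
  induction n with
  | zero => simp
  | succ n ih =>
    have hm : (2 * (n + 1) : ℝ) ≤ m := by exact_mod_cast h
    rw [Finset.sum_range_succ, ih (by omega), min_eq_left (by linarith)]
    push_cast
    ring

/-- Once `m ≤ 2 * n + 1`, the next slope `4 * n + 3 - 2 * m` is positive, so further terms
contribute nothing and the sum stabilizes at `-(m choose 2)`. -/
theorem sum_min_slope_of_ge {m n : ℕ} (h : m ≤ 2 * n + 1) :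
    ∑ i ∈ Finset.range n, min (2 * (-(m : ℝ) + 2 * ((i : ℝ) + 1)) - 1) 0 =
      -((m : ℝ) * (m - 1) / 2) := by
  induction n with
  | zero => interval_cases m <;> simp
  | succ n ih =>
    rcases le_or_gt m (2 * n + 1) with hm | hm
    · have hm' : (m : ℝ) ≤ 2 * n + 1 := by exact_mod_cast hm
      rw [Finset.sum_range_succ, ih hm, min_eq_right (by linarith), add_zero]
    · rw [sum_min_slope_of_le (by omega)]
      obtain rfl | rfl : m = 2 * n + 2 ∨ m = 2 * n + 3 := by omega
      all_goals
        push_cast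
        ring

/-- The minimization over the auxiliary variables in Ishikawa's reduction of a positive term of
degree `d`, at a labeling at which `m` literals are true. -/
theorem choose_two_add_sum_min_slope {d m : ℕ} (hd : 3 ≤ d) (hm : m ≤ d) :
    (m.choose 2 : ℝ) + ∑ i ∈ Finset.range ((d - 1) / 2),
      min ((if Odd d ∧ i + 1 = (d - 1) / 2 then 1 else 2) *
        (-(m : ℝ) + 2 * ((i : ℝ) + 1)) - 1) 0 = if m = d then 1 else 0 := by
  rw [Nat.cast_choose_two]
  rcases Nat.even_or_odd' d with ⟨k, rfl | rfl⟩
  · obtain ⟨n, rfl⟩ : ∃ n, k = n + 1 := ⟨k - 1, by omega⟩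
    have hn : (2 * (n + 1) - 1) / 2 = n := by omega
    have hodd : ¬ Odd (2 * (n + 1)) := by simp
    simp only [hn, hodd, false_and, if_false]
    -- With `d = 2 * n + 2`, the `n` auxiliary variables cancel `m choose 2` for every `m < d`; at
    -- `m = d` an excess of one remains.
    rcases hm.lt_or_eq with hlt | rfl
    · rw [sum_min_slope_of_ge (by omega), if_neg hlt.ne]
      ring
    · rw [sum_min_slope_of_le (by omega), if_pos rfl]
      push_cast
      ring
  · obtain ⟨n, rfl⟩ : ∃ n, k = n + 1 := ⟨k - 1, by omega⟩
    have hn : (2 * (n + 1) + 1 - 1) / 2 = n + 1 := by omega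
    have hodd : Odd (2 * (n + 1) + 1) := ⟨n + 1, rfl⟩
    have hc : ∀ i ∈ Finset.range n,
        min ((if Odd (2 * (n + 1) + 1) ∧ i + 1 = n + 1 then (1 : ℝ) else 2) *
          (-(m : ℝ) + 2 * ((i : ℝ) + 1)) - 1) 0 =
        min (2 * (-(m : ℝ) + 2 * ((i : ℝ) + 1)) - 1) 0 := by
      intro i hi
      have : i + 1 ≠ n + 1 := by have := Finset.mem_range.1 hi; omega
      rw [if_neg fun h => this h.2]
    -- With `d = 2 * n + 3`, the first `n` variables leave an excess of 1 at `m = d - 1` and 3 at `m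
    -- = d`. The last slope, with factor 1, is -1 and -2 there, leaving 0 and 1; factor 2 would give
    -- -3 at `m = d` and leave 0.
    rw [hn, Finset.sum_range_succ, Finset.sum_congr rfl hc, if_pos ⟨hodd, rfl⟩]
    rcases le_or_gt m (2 * n + 1) with hle | hgt
    · have hle' : (m : ℝ) ≤ 2 * n + 1 := by exact_mod_cast hle
      rw [sum_min_slope_of_ge hle, min_eq_right (by linarith), if_neg (by omega)]
      ring
    · obtain rfl | rfl : m = 2 * n + 2 ∨ m = 2 * n + 3 := by omega
      · rw [sum_min_slope_of_le (by omega), if_neg (by omega), min_eq_left (by push_cast; linarith)]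
        push_cast
        ring
      · rw [sum_min_slope_of_le (by omega), if_pos (by omega), min_eq_left (by push_cast; linarith)]
        push_cast
        ring

/-! ### A single reduction step: exactness, majorization and degree. -/

namespace ReductionStep

theorem signedCoeff_ne_zero {V : Type*} {H : EnergyHypergraph V} (r : ReductionStep H) :
    r.signedCoeff ≠ 0 :=
  mul_ne_zero (pow_ne_zero _ (by norm_num)) r.coeff_ne_zero

section Literals

variable {V : Type*} [DecidableEq V] {H : EnergyHypergraph V} (r : ReductionStep H)

/-- The nodes of the clique whose literal is true. -/
noncomputable def trueLiterals (x : V → Bool) : Finset V :=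
  r.clique.filter fun s => (decide (s ∈ r.flip) ^^ x s) = true

theorem literal_eq_ite (x : V → Bool) {s : V} (hs : s ∈ r.clique) :
    r.literal x s = if s ∈ r.trueLiterals x then 1 else 0 := by
  by_cases hf : s ∈ r.flip <;> cases hx : x s <;> simp [literal, trueLiterals, boolVal, hf, hx, hs]

theorem trueLiterals_subset (x : V → Bool) : r.trueLiterals x ⊆ r.clique :=
  Finset.filter_subset _ _

theorem sumOne_eq_card (x : V → Bool) : r.sumOne x = (r.trueLiterals x).card := by
  rw [sumOne, Finset.sum_congr rfl fun s hs => r.literal_eq_ite x hs, Finset.sum_ite_mem,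
    Finset.inter_eq_right.2 (r.trueLiterals_subset x)]
  simp

theorem prod_literal {T : Finset V} (hT : T ⊆ r.clique) (x : V → Bool) :
    ∏ s ∈ T, r.literal x s = if T ⊆ r.trueLiterals x then 1 else 0 := by
  rw [Finset.prod_congr rfl fun s hs => r.literal_eq_ite x (hT hs), Finset.prod_ite_zero]
  simp [Finset.subset_iff]

theorem sumTwo_eq_choose (x : V → Bool) :
    r.sumTwo x = ((r.trueLiterals x).card.choose 2 : ℕ) := by
  rw [sumTwo, Finset.sum_congr rfl fun T hT => r.prod_literal (Finset.mem_powersetCard.1 hT).1 x,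
    ← Finset.sum_filter, ← Finset.card_powersetCard]
  simp only [Finset.sum_const, nsmul_eq_mul, mul_one]
  congr 2
  ext T
  simp only [Finset.mem_filter, Finset.mem_powersetCard]
  constructor
  · rintro ⟨⟨_, h⟩, hT⟩; exact ⟨hT, h⟩
  · rintro ⟨hT, h⟩; exact ⟨⟨hT.trans (r.trueLiterals_subset x), h⟩, hT⟩

theorem flippedTerm_eq (x : V → Bool) :
    r.flippedTerm x =
      r.signedCoeff * if (r.trueLiterals x).card = r.clique.card then 1 else 0 := by
  rw [flippedTerm, r.prod_literal subset_rfl]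
  congr 1
  refine if_congr ⟨fun h => ?_, fun h => ?_⟩ rfl rfl
  · rw [h.antisymm' (r.trueLiterals_subset x)]
  · rw [Finset.eq_of_subset_of_card_le (r.trueLiterals_subset x) h.ge]

/-- The part of the replacing polynomial without auxiliary variables, up to the factor
`signedCoeff`. -/
noncomputable def auxBase (x : V → Bool) : ℝ := if r.signedCoeff < 0 then 0 else r.sumTwo x

/-- The factor of `sumOne` in the coefficient of an auxiliary variable. -/
noncomputable def slopeLinear (i : ℕ) : ℝ :=
  if r.signedCoeff < 0 then 1
  else -(if Odd r.clique.card ∧ i + 1 = (r.clique.card - 1) / 2 then 1 else 2)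

/-- The constant part of the coefficient of an auxiliary variable. -/
noncomputable def slopeConst (i : ℕ) : ℝ :=
  if r.signedCoeff < 0 then -((r.clique.card : ℝ) - 1)
  else (if Odd r.clique.card ∧ i + 1 = (r.clique.card - 1) / 2 then 1 else 2) *
    (2 * ((i : ℝ) + 1)) - 1

/-- The coefficient of an auxiliary variable, up to the factor `signedCoeff`. -/
noncomputable def slope (x : V → Bool) (i : ℕ) : ℝ := r.slopeLinear i * r.sumOne x + r.slopeConst i

theorem quadraticTerm_eq (x : V → Bool) (w : Fin r.numAux → Bool) :
    r.quadraticTerm x w = r.signedCoeff * (r.auxBase x + ∑ i, boolVal (w i) * r.slope x i) := by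
  unfold quadraticTerm auxBase slope slopeLinear slopeConst
  split_ifs with h
  · rw [zero_add]
    congr 1
    exact Finset.sum_congr rfl fun i _ => by ring
  · congr 2
    exact Finset.sum_congr rfl fun i _ => by ring

/-- The auxiliary variables enter linearly and separately, so the right-hand side is the minimum of
the quadratic polynomial over them. For a negative coefficient the slope is `m - (d - 1)`, positive
only when all literals are true; for a positive one this is Ishikawa's identity. -/
theorem flippedTerm_eq_min (x : V → Bool) :
    r.flippedTerm x =
      r.signedCoeff * r.auxBase x + ∑ i : Fin r.numAux, min (r.signedCoeff * r.slope x i) 0 := by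
  have hcard := Finset.card_le_card (r.trueLiterals_subset x)
  rw [r.flippedTerm_eq]
  rcases lt_or_gt_of_ne r.signedCoeff_ne_zero with ha | ha
  · have hn : (r.numAux : ℝ) = 1 := by simp [numAux, ha]
    simp only [auxBase, slope, slopeLinear, slopeConst, ha, if_true, Finset.sum_const,
      Finset.card_univ, Fintype.card_fin, nsmul_eq_mul, hn, r.sumOne_eq_card]
    split_ifs with h
    · rw [h, min_eq_left (by nlinarith)]
      ring
    · have h1 : (r.trueLiterals x).card + 1 ≤ r.clique.card := by omega
      have h2 : ((r.trueLiterals x).card + 1 : ℝ) ≤ r.clique.card := by exact_mod_cast h1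
      rw [min_eq_right (by nlinarith)]
      ring
  · have hn : r.numAux = (r.clique.card - 1) / 2 := by simp [numAux, ha.not_gt]
    rw [← choose_two_add_sum_min_slope r.three_le_card hcard, mul_add, Finset.mul_sum,
      Fin.sum_univ_eq_sum_range (fun i => min (r.signedCoeff * r.slope x i) 0), hn]
    simp only [auxBase, ha.not_gt, if_false, r.sumTwo_eq_choose]
    congr 1
    refine Finset.sum_congr rfl fun i _ => ?_
    rw [mul_min_of_nonneg _ _ ha.le, mul_zero]
    simp only [slope, slopeLinear, slopeConst, ha.not_gt, if_false, r.sumOne_eq_card]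
    congr 2
    ring

/-- The replacing quadratic polynomial majorizes the replaced summand. -/
theorem flippedTerm_le_quadraticTerm (x : V → Bool) (w : Fin r.numAux → Bool) :
    r.flippedTerm x ≤ r.quadraticTerm x w := by
  rw [r.flippedTerm_eq_min, r.quadraticTerm_eq, mul_add, Finset.mul_sum]
  refine add_le_add le_rfl (Finset.sum_le_sum fun i _ => ?_)
  cases w i <;> simp [boolVal]

/-- Optimal values of the auxiliary variables. -/
noncomputable def optAux (x : V → Bool) (i : ℕ) : Bool := decide (r.signedCoeff * r.slope x i < 0)

theorem quadraticTerm_optAux (x : V → Bool) :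
    (r.quadraticTerm x fun i => r.optAux x i) = r.flippedTerm x := by
  rw [r.flippedTerm_eq_min, r.quadraticTerm_eq, mul_add, Finset.mul_sum]
  congr 1
  refine Finset.sum_congr rfl fun i _ => ?_
  by_cases h : r.signedCoeff * r.slope x i < 0
  · simp [optAux, boolVal, h, h.le]
  · simp [optAux, boolVal, h, not_lt.1 h]

theorem trueLiterals_congr {x y : V → Bool} (h : ∀ s ∈ r.clique, x s = y s) :
    r.trueLiterals x = r.trueLiterals y :=
  Finset.filter_congr fun s hs => by rw [h s hs]

theorem dependsOn_flippedTerm : DependsOn r.flippedTerm (r.clique : Set V) := fun x y h => by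
  rw [r.flippedTerm_eq, r.flippedTerm_eq, r.trueLiterals_congr h]

theorem dependsOn_optAux (i : ℕ) :
    DependsOn (fun x => r.optAux x i) (r.clique : Set V) := fun x y h => by
  simp only [optAux, slope, r.sumOne_eq_card, r.trueLiterals_congr h]

theorem quadraticTerm_congr {x y : V → Bool} (h : ∀ s ∈ r.clique, x s = y s)
    (w : Fin r.numAux → Bool) : r.quadraticTerm x w = r.quadraticTerm y w := by
  simp only [r.quadraticTerm_eq, auxBase, slope, r.sumOne_eq_card, r.sumTwo_eq_choose,
    r.trueLiterals_congr h]

/-- The replacing polynomial is quadratic in the variables `e s` and `e' i`. -/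
theorem isQuadratic_quadraticTerm {U : Type*} [DecidableEq U] (e : V → U)
    (e' : Fin r.numAux → U) :
    IsQuadratic fun z : U → Bool =>
      r.quadraticTerm (fun s => z (e s)) fun i => z (e' i) := by
  have hlit : ∀ (z z' : U → Bool) (s : V), z (e s) = z' (e s) →
      r.literal (fun s => z (e s)) s = r.literal (fun s => z' (e s)) s := by
    intro z z' s h
    simp only [literal, h]
  simp only [r.quadraticTerm_eq]
  refine IsQuadratic.const_mul _ (IsQuadratic.add ?_ (IsQuadratic.sum fun i _ => ?_))
  · unfold auxBase
    split_ifs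
    · exact IsQuadratic.of_dependsOn (T := ∅) (fun _ _ _ => rfl) (by simp)
    · refine IsQuadratic.sum fun T hT => ?_
      refine IsQuadratic.of_dependsOn (T := T.image e) (fun z z' h => ?_)
        (Finset.card_image_le.trans (Finset.mem_powersetCard.1 hT).2.le)
      exact Finset.prod_congr rfl fun s hs =>
        hlit z z' s (h _ (Finset.mem_coe.2 (Finset.mem_image_of_mem e hs)))
  · have hexp : ∀ z : U → Bool,
        boolVal (z (e' i)) * r.slope (fun s => z (e s)) i =
          (∑ s ∈ r.clique, r.slopeLinear i *
            (boolVal (z (e' i)) * r.literal (fun s => z (e s)) s)) +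
            r.slopeConst i * boolVal (z (e' i)) := by
      intro z
      rw [← Finset.mul_sum, ← Finset.mul_sum, slope, sumOne]
      ring
    simp only [hexp]
    refine IsQuadratic.add (IsQuadratic.sum fun s _ => IsQuadratic.const_mul _ ?_)
      (IsQuadratic.const_mul _ ?_)
    · refine IsQuadratic.of_dependsOn (T := {e' i, e s}) (fun z z' h => ?_) Finset.card_le_two
      rw [h (e' i) (by simp), hlit z z' s (h (e s) (by simp))]
    · refine IsQuadratic.of_dependsOn (T := {e' i}) (fun z z' h => ?_) (by simp)
      rw [h (e' i) (by simp)]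

end Literals

end ReductionStep

/-! ### Transfer from the reduced to the original problem. -/

theorem QPBO.energy_terms {U : Type*} [Fintype U] [DecidableEq U] {F : (U → Bool) → ℝ}
    (hF : IsQuadratic F) : (QPBO.graph F).energy (QPBO.terms F) = F := by
  funext x
  have hprod : ∀ C : Finset U, ∏ s : {s // s ∈ C}, boolVal (x s.1) = ∏ s ∈ C, boolVal (x s) :=
    fun C => Finset.prod_coe_sort C fun s => boolVal (x s)
  calc (QPBO.graph F).energy (QPBO.terms F) x
      = ∑ C : {C // C ∈ (QPBO.graph F).edges},
          multilinearCoeff F C.1 * ∏ s ∈ C.1, boolVal (x s) :=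
        Finset.sum_congr rfl fun C _ => congrArg _ (hprod C.1)
    _ = ∑ C ∈ (QPBO.graph F).edges, multilinearCoeff F C * ∏ s ∈ C, boolVal (x s) :=
        Finset.sum_coe_sort (QPBO.graph F).edges fun C =>
          multilinearCoeff F C * ∏ s ∈ C, boolVal (x s)
    _ = ∑ C, multilinearCoeff F C * ∏ s ∈ C, boolVal (x s) := by
        refine Finset.sum_subset (Finset.subset_univ _) fun C _ hC => ?_
        simp only [QPBO.graph, Finset.mem_filter, Finset.mem_univ, true_and, not_or, not_and,
          not_not, not_le] at hC
        rcases (Nat.succ_le_of_lt hC.1).lt_or_eq with h | h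
        · rw [hF C h, zero_mul]
        · rw [hC.2 h.symm, zero_mul]
    _ = F x := sum_multilinearCoeff F x

namespace HOCR

section Comparison

variable {V : Type*} [DecidableEq V] {H : EnergyHypergraph V} {f : H.Vec}
  (R : HOCR H f)

theorem isQuadratic_reduced : IsQuadratic R.reduced :=
  (R.residual_quadratic.comp_embedding Function.Embedding.inl).add
    (IsQuadratic.sum fun k _ => (R.step k).isQuadratic_quadraticTerm _ _)

/-- The original nodes on which the optimal value of a node of the reduced problem depends. -/
noncomputable def scope : R.Node → Finset V
  | Sum.inl s => {s}
  | Sum.inr ⟨k, _⟩ => (R.step k).clique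

/-- The labeling of the reduced problem with optimal values of the auxiliary variables. -/
noncomputable def lift : R.Node → (V → Bool) → Bool
  | Sum.inl s, x => x s
  | Sum.inr ⟨k, i⟩, x => (R.step k).optAux x i

theorem dependsOn_lift (u : R.Node) : DependsOn (R.lift u) (R.scope u : Set V) := by
  rcases u with s | ⟨k, i⟩
  · exact fun x y h => h s (by simp [scope])
  · exact (R.step k).dependsOn_optAux i

theorem reduced_lift (x : V → Bool) : (R.reduced fun u => R.lift u x) = H.energy f x := by
  have h : ∀ k, ((R.step k).quadraticTerm (fun s => R.lift (Sum.inl s) x)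
      fun i => R.lift (Sum.inr ⟨k, i⟩) x) = (R.step k).flippedTerm x :=
    fun k => (R.step k).quadraticTerm_optAux x
  simp only [reduced, h]
  exact sub_add_cancel _ _

variable [Fintype V]

/-- The nodes of an edge of the reduced problem interact within a single hyperedge. -/
theorem biUnion_scope_mem (hH : H.DownClosed) :
    ∀ C ∈ (QPBO.graph R.reduced).edges, C.biUnion R.scope ∈ H.edges := by
  intro C hC
  -- Each summand of the reduced function involves only nodes whose scopes lie in one common
  -- hyperedge. If the joint scope of `C` is in no hyperedge, every summand misses a node of `C`, so
  -- the coefficient at `C` vanishes; only the empty set and singletons remain, and their scopes are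
  -- hyperedges.
  by_contra hnot
  have hex : ∀ D ∈ H.edges, ∃ u ∈ C, ¬ R.scope u ⊆ D := by
    intro D hD
    by_contra! h
    exact hnot (hH D hD _ (Finset.biUnion_subset.2 h))
  have hzero : ∀ (D : Finset V) (_ : D ∈ H.edges) (F : (R.Node → Bool) → ℝ),
      DependsOn F {u | R.scope u ⊆ D} → multilinearCoeff F C = 0 := by
    intro D hD F hF
    obtain ⟨u, hu, hsc⟩ := hex D hD
    exact multilinearCoeff_eq_zero_of_dependsOn hF hu hsc
  have hcoeff : multilinearCoeff R.reduced C = 0 := by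
    unfold reduced EnergyHypergraph.energy
    rw [multilinearCoeff_add, multilinearCoeff_sub, multilinearCoeff_sum, multilinearCoeff_sum,
      multilinearCoeff_sum, Finset.sum_eq_zero, Finset.sum_eq_zero, Finset.sum_eq_zero]
    · simp
    · refine fun k _ => hzero _ (R.step k).clique_mem _ fun z z' h => ?_
      rw [(R.step k).quadraticTerm_congr fun s hs => h (Sum.inl s) (by simpa [scope] using hs)]
      exact congrArg _ (funext fun i => h (Sum.inr ⟨k, i⟩) (by simp [scope]))
    · refine fun k _ => hzero _ (R.step k).clique_mem _ fun z z' h => ?_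
      exact (R.step k).dependsOn_flippedTerm fun s hs => h (Sum.inl s) (by simpa [scope] using hs)
    · refine fun D _ => hzero D.1 D.2 _ fun z z' h => ?_
      exact congrArg (f D) (funext fun s => h (Sum.inl s.1) (by simp [scope]))
  simp only [QPBO.graph, Finset.mem_filter, Finset.mem_univ, true_and, hcoeff, ne_eq,
    not_true, and_false, or_false] at hC
  rcases Nat.le_one_iff_eq_zero_or_eq_one.1 hC with h | h
  · rw [Finset.card_eq_zero.1 h] at hnot
    exact hnot H.empty_mem
  · obtain ⟨u, rfl⟩ := Finset.card_eq_one.1 h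
    rw [Finset.singleton_biUnion] at hnot
    rcases u with s | ⟨k, i⟩
    · exact hnot (H.singleton_mem s)
    · exact hnot (R.step k).clique_mem

/-- A mapping that is improving for the reduced problem is improving for the original problem. -/
theorem flpImproving_of_reduced (hH : H.DownClosed) {p : R.Node → Bool → Bool}
    (hp : (QPBO.graph R.reduced).FLPImproving (QPBO.terms R.reduced) p) :
    H.FLPImproving f fun s => p (Sum.inl s) := by
  intro ν hν
  have host := R.biUnion_scope_mem hH
  have hterms := QPBO.energy_terms R.isQuadratic_reduced
  have hpush := EnergyHypergraph.pairing_extension_pushForward hH R.dependsOn_lift host hν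
    (QPBO.terms R.reduced)
  have hid := hpush fun _ b => b
  have hle := hp _ (EnergyHypergraph.pushForward_mem_flp R.dependsOn_lift host hν)
  have hf := EnergyHypergraph.pairing_extension_eq_expect hH f hν fun _ b => b
  rw [EnergyHypergraph.extension_id] at hid hf
  rw [hid, hpush, hterms] at hle
  simp only [R.reduced_lift] at hle
  rw [hf, EnergyHypergraph.pairing_extension_eq_expect hH f hν]
  refine le_trans ?_ hle
  -- After the mapping, the auxiliary values need not be optimal for the new labels; the sum records
  -- the resulting gap, clique by clique.
  have hsplit : ∀ x : V → Bool, (R.reduced fun u => p u (R.lift u x)) =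
      H.energy f (fun s => p (Sum.inl s) (x s)) +
        ∑ k, ((R.step k).quadraticTerm (fun s => p (Sum.inl s) (x s))
          (fun i => p (Sum.inr ⟨k, i⟩) ((R.step k).optAux x i)) -
          (R.step k).flippedTerm fun s => p (Sum.inl s) (x s)) := by
    intro x
    rw [Finset.sum_sub_distrib]
    simp only [reduced, lift]
    ring
  simp only [hsplit]
  rw [EnergyHypergraph.expect_add, EnergyHypergraph.expect_sum]
  refine le_add_of_nonneg_right (Finset.sum_nonneg fun k _ => ?_)
  refine EnergyHypergraph.expect_nonneg_of_dependsOn hH hν ⟨_, (R.step k).clique_mem⟩ ?_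
    fun x => sub_nonneg.2 ((R.step k).flippedTerm_le_quadraticTerm _ _)
  intro x y h
  have hxy : ∀ s ∈ (R.step k).clique, p (Sum.inl s) (x s) = p (Sum.inl s) (y s) :=
    fun s hs => congrArg _ (h s hs)
  have hw : ∀ i : ℕ, (R.step k).optAux x i = (R.step k).optAux y i :=
    fun i => (R.step k).dependsOn_optAux i h
  dsimp only
  rw [(R.step k).quadraticTerm_congr hxy, (R.step k).dependsOn_flippedTerm hxy]
  simp only [hw]

end Comparison

end HOCR

/-! ### Feasibility of mapped labelings and node marginals. -/

namespace EnergyHypergraph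

section Marginals

variable {V : Type*} [DecidableEq V] {H : EnergyHypergraph V}

theorem extension_mem_flp {ν : H.Vec} (hν : ν ∈ H.flp) (p : V → Bool → Bool) :
    H.extension p ν ∈ H.flp := by
  refine ⟨fun C x => Finset.sum_nonneg fun _ _ => hν.1 _ _, fun x => ?_, fun C D h y => ?_⟩
  · have hx : ∀ x' : LabelingOn (∅ : Finset V), x' = x :=
      fun x' => funext fun s => absurd s.2 (Finset.notMem_empty _)
    simp [extension, hx, hν.2.1]
  · have hC := sum_mul_restrict hν C D h.subset fun z => if z.map p = y then 1 else 0
    simp only [mul_ite, mul_one, mul_zero, ← Finset.sum_filter] at hC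
    rw [extension, ← hC]
    simp only [extension]
    -- Restriction commutes with a node-wise mapping: labelings whose restriction is mapped to `y`
    -- are grouped by their image on `C`.
    rw [← Finset.sum_fiberwise_of_maps_to (s := Finset.univ.filter fun x : LabelingOn C.1 =>
      (x.restrict h.subset).map p = y)
      (t := Finset.univ.filter fun x : LabelingOn C.1 => x.restrict h.subset = y)
      (g := fun x : LabelingOn C.1 => x.map p)]
    · refine Finset.sum_congr rfl fun x hx => Finset.sum_congr ?_ fun _ _ => rfl
      ext x'
      simp only [Finset.mem_filter, Finset.mem_univ, true_and] at hx ⊢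
      refine ⟨fun h' => ⟨?_, h'⟩, fun h' => h'.2⟩
      rw [← hx, ← h']
      rfl
    · intro x hx
      exact Finset.mem_filter.2 ⟨Finset.mem_univ _, (Finset.mem_filter.1 hx).2⟩

theorem le_marginal {ν : H.Vec} (hν : ν ∈ H.flp) (C : {C : Finset V // C ∈ H.edges})
    {s : V} (hs : s ∈ C.1) (x : LabelingOn C.1) :
    ν C x ≤ ν ⟨{s}, H.singleton_mem s⟩ fun _ => x ⟨s, hs⟩ := by
  have hr : x.restrict (Finset.singleton_subset_iff.2 hs) = fun _ => x ⟨s, hs⟩ := by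
    funext t
    obtain ⟨t, ht⟩ := t
    obtain rfl := Finset.mem_singleton.1 ht
    rfl
  have h := sum_mul_restrict hν C ⟨{s}, H.singleton_mem s⟩ (Finset.singleton_subset_iff.2 hs)
    fun y => if y = x.restrict (Finset.singleton_subset_iff.2 hs) then 1 else 0
  simp only [mul_ite, mul_one, mul_zero, Finset.sum_ite_eq', Finset.mem_univ, if_true] at h
  rw [← hr, ← h, ← Finset.sum_filter]
  exact Finset.single_le_sum (f := fun x => ν C x) (fun _ _ => hν.1 _ _) (by simp)

theorem exists_pos_of_marginal_pos {ν : H.Vec} (hν : ν ∈ H.flp)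
    (C : {C : Finset V // C ∈ H.edges}) {s : V} (hs : s ∈ C.1) {b : Bool}
    (hb : 0 < ν ⟨{s}, H.singleton_mem s⟩ fun _ => b) :
    ∃ x : LabelingOn C.1, x ⟨s, hs⟩ = b ∧ 0 < ν C x := by
  have h := sum_mul_restrict hν C ⟨{s}, H.singleton_mem s⟩ (Finset.singleton_subset_iff.2 hs)
    fun y => if y = fun _ => b then 1 else 0
  simp only [mul_ite, mul_one, mul_zero, Finset.sum_ite_eq', Finset.mem_univ, if_true] at h
  rw [← h, ← Finset.sum_filter] at hb
  obtain ⟨x, hx, hpos⟩ := Finset.exists_lt_of_sum_lt (f := fun _ => (0 : ℝ)) (by simpa using hb)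
  exact ⟨x, congrFun (Finset.mem_filter.1 hx).2 ⟨s, Finset.mem_singleton_self s⟩, hpos⟩

theorem marginal_add {ν : H.Vec} (hν : ν ∈ H.flp) (s : V) (b : Bool) :
    (ν ⟨{s}, H.singleton_mem s⟩ fun _ => b) + (ν ⟨{s}, H.singleton_mem s⟩ fun _ => !b) = 1 := by
  have h := sum_eq_one hν ⟨{s}, H.singleton_mem s⟩
  have hne : (fun _ : {t // t ∈ ({s} : Finset V)} => b) ≠ fun _ => !b := fun h => by
    have := congrFun h ⟨s, Finset.mem_singleton_self s⟩
    simp at this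
  rw [← h, Fintype.sum_eq_add _ _ hne]
  rintro x ⟨h1, h2⟩
  exfalso
  have hx : x = fun _ => x ⟨s, Finset.mem_singleton_self s⟩ := by
    funext t
    obtain ⟨t, ht⟩ := t
    obtain rfl := Finset.mem_singleton.1 ht
    rfl
  by_cases hv : x ⟨s, Finset.mem_singleton_self s⟩ = b
  · exact h1 (by rw [hx, hv])
  · exact h2 (by rw [hx, Bool.eq_not_of_ne hv])

theorem pairing_add_smul_sub (f μ ν ρ : H.Vec) (ε : ℝ) :
    H.pairing f (fun C x => μ C x + ε * (ν C x - ρ C x)) =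
      H.pairing f μ + ε * (H.pairing f ν - H.pairing f ρ) := by
  simp only [pairing, ← Finset.sum_sub_distrib, Finset.mul_sum, ← Finset.sum_add_distrib]
  exact Finset.sum_congr rfl fun C _ => Finset.sum_congr rfl fun x _ => by ring

end Marginals

end EnergyHypergraph

/-! ### Persistency of the roof dual. -/

namespace QPBO

section Persistency

variable {U : Type*} [Fintype U] [DecidableEq U] {F : (U → Bool) → ℝ} {μ : (graph F).Vec}

theorem persistent_overwrite {s : U}
    (hs : ∃ b, Persistent μ s b) (b : Bool) : Persistent μ s (overwrite μ s b) := by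
  unfold overwrite
  split_ifs with h1 h2
  · exact h1
  · exact h2
  · obtain ⟨b', hb'⟩ := hs
    cases b'
    · exact absurd hb' h2
    · exact absurd hb' h1

theorem overwrite_of_not_persistent {s : U} (hs : ¬ ∃ b, Persistent μ s b) (b : Bool) :
    overwrite μ s b = b := by
  push Not at hs
  simp [overwrite, hs]

theorem marginal_pos_of_not_persistent (hμ : μ ∈ (graph F).flp) {s : U}
    (hs : ¬ ∃ b, Persistent μ s b) (b : Bool) :
    0 < μ ⟨{s}, (graph F).singleton_mem s⟩ fun _ => b := by
  refine lt_of_le_of_ne (hμ.1 _ _) fun h => hs ⟨!b, ?_⟩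
  have := EnergyHypergraph.marginal_add hμ s b
  rw [← h, zero_add] at this
  exact this

/-- Where the overwrite mapping adds mass to a relaxed labeling, `μ` is positive. -/
theorem pos_of_lt_extension_overwrite (hμ : μ ∈ (graph F).flp) {ν : (graph F).Vec}
    (hν : ν ∈ (graph F).flp) {C : {C : Finset U // C ∈ (graph F).edges}}
    {x : EnergyHypergraph.LabelingOn C.1}
    (hlt : ν C x < (graph F).extension (overwrite μ) ν C x) : 0 < μ C x := by
  have hcard : C.1.card ≤ 2 := by
    have := C.2
    simp only [graph, Finset.mem_filter] at this
    omega
  obtain ⟨x', hx'⟩ : ∃ x' : EnergyHypergraph.LabelingOn C.1, x'.map (overwrite μ) = x := by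
    by_contra! h
    rw [EnergyHypergraph.extension, Finset.sum_eq_zero] at hlt
    · exact absurd (hν.1 C x) hlt.not_ge
    · exact fun x' hx' => absurd (Finset.mem_filter.1 hx').2 (h x')
  have hpers : ∀ s (hs : s ∈ C.1), (∃ b, Persistent μ s b) → Persistent μ s (x ⟨s, hs⟩) := by
    intro s hs h
    rw [← hx']
    exact persistent_overwrite h _
  have hmarg : ∀ s (hs : s ∈ C.1),
      0 < μ ⟨{s}, (graph F).singleton_mem s⟩ fun _ => x ⟨s, hs⟩ := by
    intro s hs
    by_cases h : ∃ b, Persistent μ s b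
    · rw [show μ ⟨{s}, _⟩ (fun _ => x ⟨s, hs⟩) = 1 from hpers s hs h]
      exact one_pos
    · exact marginal_pos_of_not_persistent hμ h _
  -- An edge has at most two nodes. If `s` is integral, positive mass at the label of the other node
  -- `t` (possibly `t = s`) must sit on a labeling agreeing with `x` at `s`, hence on `x`. If no
  -- node is integral, overwriting is the identity on `C` and adds no mass.
  by_cases hex : ∃ s ∈ C.1, ∃ b, Persistent μ s b
  · obtain ⟨s, hs, hsp⟩ := hex
    obtain ⟨t, ht, hst⟩ : ∃ t ∈ C.1, ∀ u ∈ C.1, u = s ∨ u = t := by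
      by_contra! h
      obtain ⟨t, ht, hts, -⟩ := h s hs
      obtain ⟨u, hu, hus, hut⟩ := h t ht
      have : ({s, t, u} : Finset U) ⊆ C.1 := by
        simp [Finset.insert_subset_iff, hs, ht, hu]
      have h3 := Finset.card_le_card this
      rw [Finset.card_eq_three.2 ⟨s, t, u, hts.symm, hus.symm, hut.symm, rfl⟩] at h3
      omega
    obtain ⟨x₁, hx₁, hpos⟩ := EnergyHypergraph.exists_pos_of_marginal_pos hμ C ht (hmarg t ht)
    have hs₁ : x₁ ⟨s, hs⟩ = x ⟨s, hs⟩ := by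
      by_contra hne
      have h1 := EnergyHypergraph.le_marginal hμ C hs x₁
      have h2 := EnergyHypergraph.marginal_add hμ s (x ⟨s, hs⟩)
      have h3 : μ ⟨{s}, _⟩ (fun _ => x ⟨s, hs⟩) = 1 := hpers s hs hsp
      rw [Bool.eq_not_of_ne hne] at h1
      linarith
    have : x₁ = x := by
      funext ⟨u, hu⟩
      rcases hst u hu with rfl | rfl
      · exact hs₁
      · exact hx₁
    rwa [this] at hpos
  · exfalso
    push Not at hex
    have hmap : ∀ x' : EnergyHypergraph.LabelingOn C.1, x'.map (overwrite μ) = x' := by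
      intro x'
      funext s
      exact overwrite_of_not_persistent (by simpa using hex s.1 s.2) _
    simp [EnergyHypergraph.extension, hmap, Finset.sum_filter] at hlt

/-- Persistency of the roof dual: overwriting with the integral part of an optimal solution is
improving. -/
theorem IsOptimal.flpImproving_overwrite (hμ : IsOptimal F μ) :
    (graph F).FLPImproving (terms F) (overwrite μ) := by
  intro ν hν
  have hρ := EnergyHypergraph.extension_mem_flp hν (overwrite μ)
  set ρ := (graph F).extension (overwrite μ) ν with hρ_def
  -- Perturbing `μ` along `ν - ρ` keeps all components nonnegative for small positive `ε`: a
  -- component decreases only where overwriting adds mass to `ν`, and there `μ` is positive. There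
  -- are finitely many components.
  have hev : ∀ᶠ ε : ℝ in nhdsWithin 0 (Set.Ioi 0),
      ∀ C, ∀ x, 0 ≤ μ C x + ε * (ν C x - ρ C x) := by
    refine Filter.eventually_all.2 fun C => Filter.eventually_all.2 fun x => ?_
    rcases le_or_gt (ρ C x) (ν C x) with h | h
    · filter_upwards [self_mem_nhdsWithin] with ε hε
      exact add_nonneg (hμ.1.1 C x) (mul_nonneg (le_of_lt hε) (sub_nonneg.2 h))
    · have hpos : 0 < μ C x := pos_of_lt_extension_overwrite hμ.1 hν h
      have hcont : Continuous fun ε : ℝ => μ C x + ε * (ν C x - ρ C x) := by fun_prop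
      have h0 : Filter.Tendsto (fun ε : ℝ => μ C x + ε * (ν C x - ρ C x)) (nhds 0)
          (nhds (μ C x)) := by
        simpa using hcont.tendsto 0
      exact (h0.mono_left nhdsWithin_le_nhds).eventually (Ici_mem_nhds hpos)
  obtain ⟨ε, hnonneg, hε⟩ := (hev.and self_mem_nhdsWithin).exists
  have hmem : (fun C x => μ C x + ε * (ν C x - ρ C x)) ∈ (graph F).flp := by
    refine ⟨hnonneg, fun x => ?_, fun C D h y => ?_⟩
    · dsimp only
      rw [hμ.1.2.1, hν.2.1, hρ.2.1]
      ring
    · rw [Finset.sum_add_distrib, ← Finset.mul_sum, Finset.sum_sub_distrib, hμ.1.2.2 C D h y,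
        hν.2.2 C D h y, hρ.2.2 C D h y]
  have hopt := hμ.2 _ hmem
  rw [EnergyHypergraph.pairing_add_smul_sub] at hopt
  have hε' : (0 : ℝ) < ε := hε
  have : 0 ≤ (graph F).pairing (terms F) ν - (graph F).pairing (terms F) ρ :=
    nonneg_of_mul_nonneg_right (by linarith) hε'
  linarith

end Persistency

end QPBO

theorem mainTheorem9 {V : Type*} [Fintype V] [DecidableEq V] (H : EnergyHypergraph V)
    (hH : H.DownClosed) (f : H.Vec) (R : HOCR H f) :
    (∀ p' : R.Node → Bool → Bool,
      (QPBO.graph R.reduced).FLPImproving (QPBO.terms R.reduced) p' →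
        H.FLPImproving f (fun s => p' (Sum.inl s))) ∧
    ∀ μ : (QPBO.graph R.reduced).Vec, QPBO.IsOptimal R.reduced μ →
      H.FLPImproving f (fun s => QPBO.overwrite μ (Sum.inl s)) := by
  exact ⟨fun p hp => R.flpImproving_of_reduced hH hp,
    fun μ hμ => R.flpImproving_of_reduced hH hμ.flpImproving_overwrite⟩
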